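/- All Banach spaces are over the field $\mathbb{K}$, where $\mathbb{K}=\mathbb{R}$ or $\mathbb{K}=\mathbb{C}$, subspaces are closed, and isomorphic means linearly homeomorphic. Let $c_0$ be the Banach space of all sequences in $\mathbb{K}$ that converge to $0$, with the supremum norm. A Banach space $X$ is called hereditarily $c_0$ if every infinite-dimensional subspace of $X$ contains a subspace isomorphic to $c_0$. It is called subprojective if every infinite-dimensional subspace of $X$ contains an infinite-dimensional subspace that is complemented in $X$ (the range of a bounded linear projection on $X$). Proposition. Every hereditarily-$c_0$ Banach space is subprojective. -/

import Mathlib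

open scoped ZeroAtInfty

/-- `X` is hereditarily `Z`: every infinite-dimensional closed subspace of `X` contains a closed
subspace that is isomorphic (linearly homeomorphic) to `Z`. -/
def IsHereditarily (𝕜 : Type*) [RCLike 𝕜]
    (Z : Type*) [NormedAddCommGroup Z] [NormedSpace 𝕜 Z]
    (X : Type*) [NormedAddCommGroup X] [NormedSpace 𝕜 X] : Prop :=
  ∀ M : Submodule 𝕜 X, IsClosed (M : Set X) → ¬ FiniteDimensional 𝕜 M →
    ∃ N : Submodule 𝕜 X, N ≤ M ∧ IsClosed (N : Set X) ∧ Nonempty (N ≃L[𝕜] Z)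

/-- `X` is subprojective: every infinite-dimensional closed subspace of `X` contains an
infinite-dimensional closed subspace that is complemented in `X`, that is, the range of a
continuous linear projection on `X`. -/
def IsSubprojective (𝕜 : Type*) [RCLike 𝕜]
    (X : Type*) [NormedAddCommGroup X] [NormedSpace 𝕜 X] : Prop :=
  ∀ M : Submodule 𝕜 X, IsClosed (M : Set X) → ¬ FiniteDimensional 𝕜 M →
    ∃ N : Submodule 𝕜 X, N ≤ M ∧ IsClosed (N : Set X) ∧ ¬ FiniteDimensional 𝕜 N ∧
      N.ClosedComplemented

/-- The Banach space `c₀` of scalar sequences that converge to `0`, with the supremum norm: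
the functions on the discrete space `ℕ` that vanish at infinity. -/
abbrev SeqCZero (𝕜 : Type*) [RCLike 𝕜] : Type _ := C₀(ℕ, 𝕜)

/-! Let `f i` be Hahn–Banach extensions to $X$ of the coordinates of a copy of $c_0$. If they were
weak* null, they would define a projection onto the copy. In general a weak* Cauchy sequence of
convex combinations suffices: take such combinations over disjoint blocks of indices and subtract
each odd one from the preceding even one. The differences are weak* null, hence an operator into
$c_0$, and they are biorthogonal to vectors of the copy that are constant on the even blocks and
zero on the odd ones (`exists_complemented_of_convexTail`).

The Cauchy sequence exists because $X$ contains no $\ell^1$: a copy of $\ell^1$ would contain $c_0$,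
which `not_exists_seqCZero_to_lp_one` excludes. Pass to a convex tail whose oscillation $\delta$ on
the unit ball cannot be lowered by further convex combinations. If $\delta = 0$ it is weak* Cauchy.
If $\delta > 0$, averages of finitely many subsequences still oscillate by nearly $\delta$, which
forces all of these subsequences to oscillate together at one vector (`exists_splitting`). Iterating
along a binary tree gives a Boolean independent sequence of vectors, and hence $\ell^1$ in $X$. -/

open Filter Topology

/-- Every term of `g` far enough out is a convex combination of terms of `f` arbitrarily far out. -/
def IsConvexTail {E : Type*} [AddCommGroup E] [Module ℝ E] (g f : ℕ → E) : Prop :=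
  ∀ N, ∀ᶠ n in atTop, g n ∈ convexHull ℝ (f '' Set.Ici N)

/-! ### Convex tails: transitivity, diagonals, averages, finite windows -/

namespace IsConvexTail

variable {E : Type*} [AddCommGroup E] [Module ℝ E] {f g h : ℕ → E}

theorem refl (f : ℕ → E) : IsConvexTail f f := fun N => by
  filter_upwards [eventually_ge_atTop N] with n hn
  exact subset_convexHull ℝ _ ⟨n, hn, rfl⟩

theorem exists_hull_subset (h : IsConvexTail g f) (N : ℕ) :
    ∃ K, convexHull ℝ (g '' Set.Ici K) ⊆ convexHull ℝ (f '' Set.Ici N) := by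
  obtain ⟨K, hK⟩ := eventually_atTop.1 (h N)
  refine ⟨K, convexHull_min ?_ (convex_convexHull ℝ _)⟩
  rintro _ ⟨n, hn, rfl⟩
  exact hK n hn

theorem trans (h₁ : IsConvexTail h g) (h₂ : IsConvexTail g f) : IsConvexTail h f := fun N => by
  obtain ⟨K, hK⟩ := h₂.exists_hull_subset N
  exact (h₁ K).mono fun n hn => hK hn

/-- A decreasing sequence of sequences has a common convex tail. -/
theorem exists_diagonal (G : ℕ → ℕ → E) (hG : ∀ k, IsConvexTail (G (k + 1)) (G k)) :
    ∃ g, ∀ k, IsConvexTail g (G k) := by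
  have hle : ∀ j n, j ≤ n → IsConvexTail (G n) (G j) := by
    intro j n hjn
    induction n, hjn using Nat.le_induction with
    | base => exact refl _
    | succ n _ ih => exact (hG n).trans ih
  -- Only finitely many rows `j ≤ n` constrain the `n`-th diagonal term, so one position far along
  -- row `n` serves them all.
  have key : ∀ n, ∃ m, ∀ j ∈ Set.Iic n, G n m ∈ convexHull ℝ (G j '' Set.Ici n) := by
    intro n
    have : ∀ᶠ m in atTop, ∀ j ∈ Set.Iic n, G n m ∈ convexHull ℝ (G j '' Set.Ici n) :=
      (eventually_all_finite (Set.finite_Iic n)).2 fun j hj => hle j n hj n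
    exact this.exists
  choose m hm using key
  refine ⟨fun n => G n (m n), fun k N => ?_⟩
  filter_upwards [eventually_ge_atTop k, eventually_ge_atTop N] with n hk hN
  exact convexHull_mono (Set.image_mono (Set.Ici_subset_Ici.2 hN)) (hm n k hk)

/-- The averages of finitely many reindexings of `f` form a convex tail of `f`. -/
theorem average (f : ℕ → E) (T : Finset (ℕ → ℕ)) (hT : T.Nonempty)
    (hψ : ∀ ψ ∈ T, Tendsto ψ atTop atTop) :
    IsConvexTail (fun n => ∑ ψ ∈ T, (T.card : ℝ)⁻¹ • f (ψ n)) f := fun N => by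
  have : ∀ᶠ n in atTop, ∀ ψ ∈ T, N ≤ ψ n :=
    (eventually_all_finset T).2 fun ψ h => (hψ ψ h).eventually_ge_atTop N
  filter_upwards [this] with n hn
  refine (convex_convexHull ℝ _).sum_mem (fun _ _ => by positivity) ?_
    fun ψ h => subset_convexHull ℝ _ ⟨ψ n, hn ψ h, rfl⟩
  have : (T.card : ℝ) ≠ 0 := by exact_mod_cast hT.card_pos.ne'
  simp [this]

/-- A convex combination involves finitely many terms, so the hull of a tail is the increasing union
of the hulls of its finite windows. The strict `N < M` lets windows be chained into consecutive
blocks. -/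
theorem exists_mem_convexHull_Ico (h : IsConvexTail g f) (N : ℕ) :
    ∃ M n, N < M ∧ N ≤ n ∧ g n ∈ convexHull ℝ (f '' Set.Ico N M) := by
  obtain ⟨n, hn, hNn⟩ := ((h N).and (eventually_ge_atTop N)).exists
  have hdir : Directed (· ⊆ ·) fun M => convexHull ℝ (f '' Set.Ico N M) :=
    directed_of_isDirected_le fun a b hab =>
      convexHull_mono (Set.image_mono (Set.Ico_subset_Ico_right hab))
  have hsub : convexHull ℝ (f '' Set.Ici N) ⊆ ⋃ M, convexHull ℝ (f '' Set.Ico N M) := by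
    refine convexHull_min ?_ (hdir.convex_iUnion fun M => convex_convexHull ℝ _)
    rintro _ ⟨i, hi, rfl⟩
    exact Set.mem_iUnion.2 ⟨i + 1, subset_convexHull ℝ _ ⟨i, ⟨hi, Nat.lt_succ_self i⟩, rfl⟩⟩
  obtain ⟨M, hM⟩ := Set.mem_iUnion.1 (hsub hn)
  refine ⟨max M (N + 1), n, by omega, hNn, ?_⟩
  exact convexHull_mono (Set.image_mono (Set.Ico_subset_Ico_right (le_max_left _ _))) hM

end IsConvexTail

/-! ### Oscillation on the unit ball and its minimization -/

section Oscillation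

variable {𝕜 : Type*} [RCLike 𝕜] {X : Type*} [NormedAddCommGroup X] [NormedSpace 𝕜 X]

/-- Closed balls of scalars are convex, so the bound passes to the hulls one variable at a time. -/
theorem norm_apply_sub_apply_le_of_mem_convexHull {s t : Set (StrongDual 𝕜 X)} {x : X} {d : ℝ}
    (h : ∀ u ∈ s, ∀ v ∈ t, ‖u x - v x‖ ≤ d) {u v : StrongDual 𝕜 X}
    (hu : u ∈ convexHull ℝ s) (hv : v ∈ convexHull ℝ t) : ‖u x - v x‖ ≤ d := by
  let ev : StrongDual 𝕜 X →ₗ[ℝ] 𝕜 :=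
    { toFun := fun u => u x, map_add' := fun _ _ => rfl, map_smul' := fun _ _ => rfl }
  have key : ∀ (r : Set (StrongDual 𝕜 X)) (c : 𝕜), (∀ w ∈ r, ‖w x - c‖ ≤ d) →
      ∀ w ∈ convexHull ℝ r, ‖w x - c‖ ≤ d := by
    intro r c hr w hw
    have : convexHull ℝ r ⊆ ev ⁻¹' Metric.closedBall c d :=
      convexHull_min (fun w hw => by simpa [dist_eq_norm, ev] using hr w hw)
        ((convex_closedBall c d).linear_preimage ev)
    simpa [dist_eq_norm, ev] using this hw
  refine key s (v x) (fun u hu => ?_) u hu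
  rw [norm_sub_rev]
  refine key t (u x) (fun v hv => ?_) v hv
  rw [norm_sub_rev]
  exact h u hu v hv

/-- On each vector of the unit ball the sequence `f` eventually oscillates by at most `d`. -/
def OscLE (f : ℕ → StrongDual 𝕜 X) (d : ℝ) : Prop :=
  ∀ x : X, ‖x‖ ≤ 1 → ∃ N, ∀ n ≥ N, ∀ m ≥ N, ‖f n x - f m x‖ ≤ d

theorem OscLE.nonneg {f : ℕ → StrongDual 𝕜 X} {d : ℝ} (h : OscLE f d) : 0 ≤ d := by
  obtain ⟨N, hN⟩ := h 0 (by simp)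
  exact (norm_nonneg _).trans (hN N le_rfl N le_rfl)

theorem OscLE.mono {f : ℕ → StrongDual 𝕜 X} {d e : ℝ} (h : OscLE f d) (hde : d ≤ e) :
    OscLE f e := fun x hx => by
  obtain ⟨N, hN⟩ := h x hx
  exact ⟨N, fun n hn m hm => (hN n hn m hm).trans hde⟩

theorem OscLE.exists_convexHull {f : ℕ → StrongDual 𝕜 X} {d : ℝ} (h : OscLE f d) {x : X}
    (hx : ‖x‖ ≤ 1) : ∃ N, ∀ u ∈ convexHull ℝ (f '' Set.Ici N),
      ∀ v ∈ convexHull ℝ (f '' Set.Ici N), ‖u x - v x‖ ≤ d := by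
  obtain ⟨N, hN⟩ := h x hx
  refine ⟨N, fun u hu v hv => norm_apply_sub_apply_le_of_mem_convexHull ?_ hu hv⟩
  rintro _ ⟨n, hn, rfl⟩ _ ⟨m, hm, rfl⟩
  exact hN n hn m hm

theorem OscLE.of_isConvexTail {f g : ℕ → StrongDual 𝕜 X} {d : ℝ} (h : OscLE f d)
    (hg : IsConvexTail g f) : OscLE g d := fun x hx => by
  obtain ⟨N, hN⟩ := h.exists_convexHull hx
  obtain ⟨K, hK⟩ := eventually_atTop.1 (hg N)
  exact ⟨K, fun n hn m hm => hN _ (hK n hn) _ (hK m hm)⟩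

theorem oscLE_of_norm_le {f : ℕ → StrongDual 𝕜 X} {C : ℝ} (hf : ∀ n, ‖f n‖ ≤ C) :
    OscLE f (2 * C) := fun x hx => by
  have hle : ∀ n, ‖f n x‖ ≤ C := fun n =>
    ((f n).le_of_opNorm_le_of_le (hf n) hx).trans_eq (mul_one C)
  exact ⟨0, fun n _ m _ => (norm_sub_le _ _).trans (by linarith [hle n, hle m])⟩

/-- The oscillation of a sequence of functionals, uniformly over the unit ball. -/
noncomputable def osc (f : ℕ → StrongDual 𝕜 X) : ℝ := sInf {d | OscLE f d}

theorem bddBelow_oscLE (f : ℕ → StrongDual 𝕜 X) : BddBelow {d | OscLE f d} :=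
  ⟨0, fun _ h => OscLE.nonneg h⟩

/-- The finite bound `C` matters: `sInf` of the empty set is `0`, so without it `osc f` could be
spuriously small. -/
theorem osc_le_of_isConvexTail {f g : ℕ → StrongDual 𝕜 X} {C : ℝ} (hf : OscLE f C)
    (hg : IsConvexTail g f) : osc g ≤ osc f :=
  csInf_le_csInf (bddBelow_oscLE g) ⟨C, hf⟩ fun _ h => OscLE.of_isConvexTail h hg

/-- Every sequence of finite oscillation has a convex tail none of whose convex tails oscillates
less. -/
theorem exists_isConvexTail_osc_minimal {f : ℕ → StrongDual 𝕜 X} {C : ℝ} (hf : OscLE f C) :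
    ∃ g, IsConvexTail g f ∧ ∃ δ, 0 ≤ δ ∧ (∀ d > δ, OscLE g d) ∧
      ∀ h, IsConvexTail h g → ∀ d < δ, ¬ OscLE h d := by
  have step : ∀ (k : ℕ) (u : ℕ → StrongDual 𝕜 X), ∃ v, IsConvexTail v u ∧
      ∀ h, IsConvexTail h u → osc v ≤ osc h + 1 / ((k : ℝ) + 1) := by
    intro k u
    have hbdd : BddBelow (osc '' {h | IsConvexTail h u}) :=
      ⟨0, by rintro _ ⟨h, -, rfl⟩; exact Real.sInf_nonneg fun _ h => OscLE.nonneg h⟩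
    have hlt : sInf (osc '' {h | IsConvexTail h u})
        < sInf (osc '' {h | IsConvexTail h u}) + 1 / ((k : ℝ) + 1) :=
      lt_add_of_pos_right _ (by positivity)
    obtain ⟨_, ⟨v, hv, rfl⟩, hlt⟩ :=
      exists_lt_of_csInf_lt (Set.Nonempty.image osc ⟨u, IsConvexTail.refl u⟩) hlt
    refine ⟨v, hv, fun h hh => hlt.le.trans ?_⟩
    gcongr
    exact csInf_le hbdd ⟨h, hh, rfl⟩
  choose next hnext hosc using step
  obtain ⟨G, hG0, hGs⟩ : ∃ G : ℕ → ℕ → StrongDual 𝕜 X, G 0 = f ∧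
      ∀ k, G (k + 1) = next k (G k) := ⟨fun k => Nat.rec f (fun k u => next k u) k, rfl, fun _ => rfl⟩
  have hGt : ∀ k, IsConvexTail (G (k + 1)) (G k) := fun k => hGs k ▸ hnext k (G k)
  obtain ⟨g, hg⟩ := IsConvexTail.exists_diagonal G hGt
  have hGf : ∀ k, OscLE (G k) C := fun k => by
    induction k with
    | zero => exact hG0 ▸ hf
    | succ k ih => exact ih.of_isConvexTail (hGt k)
  have hgC : OscLE g C := (hGf 0).of_isConvexTail (hg 0)
  refine ⟨g, hG0 ▸ hg 0, osc g, Real.sInf_nonneg fun _ h => OscLE.nonneg h, fun d hd => ?_, ?_⟩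
  · obtain ⟨e, he, hed⟩ := exists_lt_of_csInf_lt ⟨C, hgC⟩ hd
    exact OscLE.mono he hed.le
  · intro h hh d hd hhd
    refine hd.not_ge (le_trans ?_ (csInf_le (bddBelow_oscLE h) hhd))
    refine le_of_forall_pos_le_add fun ε hε => ?_
    obtain ⟨k, hk⟩ := exists_nat_one_div_lt hε
    -- A convex tail of `g` is one of every `G k`, so `h` already competed in the near-minimization
    -- at stage `k`.
    calc osc g ≤ osc (G (k + 1)) := osc_le_of_isConvexTail (hGf _) (hg _)
      _ ≤ osc h + 1 / ((k : ℝ) + 1) := hGs k ▸ hosc k (G k) h (hh.trans (hg k))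
      _ ≤ osc h + ε := by gcongr

/-- Variance identity: $\sum |v_j - c|^2 = \sum |v_j|^2 - |T|\,|c|^2$ for the average $c$. If the
average is nearly as large as the bound on the individual terms, every term is close to it. -/
theorem norm_sub_average_sq_le {ι : Type*} (T : Finset ι) (v : ι → 𝕜) (c : 𝕜) {d e : ℝ}
    (hc : ∑ i ∈ T, v i = T.card * c) (hv : ∀ i ∈ T, ‖v i‖ ≤ d) (he : 0 ≤ e) (hec : e ≤ ‖c‖)
    {i : ι} (hi : i ∈ T) : ‖v i - c‖ ^ 2 ≤ T.card * (d ^ 2 - e ^ 2) := by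
  have hsum : ∑ j ∈ T, ‖v j - c‖ ^ 2 = ∑ j ∈ T, ‖v j‖ ^ 2 - T.card * ‖c‖ ^ 2 := by
    have hin : ∑ j ∈ T, RCLike.re (inner 𝕜 (v j) c) = T.card * ‖c‖ ^ 2 := by
      rw [← map_sum, ← sum_inner, hc]
      have : inner 𝕜 ((T.card : 𝕜) * c) c = ((T.card * ‖c‖ ^ 2 : ℝ) : 𝕜) := by
        rw [← smul_eq_mul, inner_smul_left, inner_self_eq_norm_sq_to_K]
        simp
      rw [this, RCLike.ofReal_re]
    simp only [norm_sub_sq (𝕜 := 𝕜), Finset.sum_add_distrib, Finset.sum_sub_distrib,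
      ← Finset.mul_sum, hin, Finset.sum_const, nsmul_eq_mul]
    ring
  calc ‖v i - c‖ ^ 2 ≤ ∑ j ∈ T, ‖v j - c‖ ^ 2 :=
        Finset.single_le_sum (f := fun j => ‖v j - c‖ ^ 2) (fun _ _ => by positivity) hi
    _ = ∑ j ∈ T, ‖v j‖ ^ 2 - T.card * ‖c‖ ^ 2 := hsum
    _ ≤ ∑ _j ∈ T, d ^ 2 - T.card * e ^ 2 := by
        gcongr with j hj
        exact hv j hj
    _ = T.card * (d ^ 2 - e ^ 2) := by simp; ring

end Oscillation

/-! ### The spaces $c_0$ and $\ell^1$ -/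

section SequenceSpaces

variable {𝕜 : Type*} [RCLike 𝕜]

theorem not_finiteDimensional_of_biorthogonal {V : Type*} [AddCommGroup V] [Module 𝕜 V]
    (e : ℕ → V) (φ : ℕ → V →ₗ[𝕜] 𝕜) (h : ∀ i j, φ j (e i) = if i = j then 1 else 0) :
    ¬ FiniteDimensional 𝕜 V := by
  intro hfin
  have hli : LinearIndependent 𝕜 e := by
    rw [linearIndependent_iff']
    intro s a ha j hj
    have := congrArg (φ j) ha
    simpa [h, hj] using this
  exact Set.infinite_univ (α := ℕ) (Set.finite_univ_iff.2 hli.finite)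

namespace SeqCZero

/-- The element of `c₀` given by a null sequence. -/
noncomputable def ofTendsto (a : ℕ → 𝕜) (ha : Tendsto a atTop (𝓝 0)) : SeqCZero 𝕜 where
  toFun := a
  continuous_toFun := continuous_of_discreteTopology
  zero_at_infty' := by rwa [cocompact_eq_cofinite, Nat.cofinite_eq_atTop]

@[simp] theorem ofTendsto_apply (a : ℕ → 𝕜) (ha : Tendsto a atTop (𝓝 0)) (n : ℕ) :
    ofTendsto a ha n = a n := rfl

theorem tendsto (a : SeqCZero 𝕜) : Tendsto a atTop (𝓝 0) := by
  have := a.zero_at_infty'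
  rwa [cocompact_eq_cofinite, Nat.cofinite_eq_atTop] at this

theorem norm_apply_le (a : SeqCZero 𝕜) (n : ℕ) : ‖a n‖ ≤ ‖a‖ :=
  (a.toBCF.norm_coe_le_norm n).trans_eq (ZeroAtInftyContinuousMap.norm_toBCF_eq_norm)

theorem norm_le {a : SeqCZero 𝕜} {C : ℝ} (hC : 0 ≤ C) (h : ∀ n, ‖a n‖ ≤ C) : ‖a‖ ≤ C := by
  rw [← ZeroAtInftyContinuousMap.norm_toBCF_eq_norm]
  exact (BoundedContinuousFunction.norm_le hC).2 h

/-- The coordinate functionals of `c₀`. -/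
noncomputable def coord (n : ℕ) : StrongDual 𝕜 (SeqCZero 𝕜) :=
  LinearMap.mkContinuous
    { toFun := fun a => a n, map_add' := fun _ _ => rfl, map_smul' := fun _ _ => rfl } 1
    fun a => by simpa using norm_apply_le a n

@[simp] theorem coord_apply (n : ℕ) (a : SeqCZero 𝕜) : coord n a = a n := rfl

theorem norm_coord_le (n : ℕ) : ‖(coord n : StrongDual 𝕜 (SeqCZero 𝕜))‖ ≤ 1 :=
  LinearMap.mkContinuous_norm_le _ zero_le_one _

/-- The unit vectors of `c₀`. -/
noncomputable def unit (n : ℕ) : SeqCZero 𝕜 :=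
  ofTendsto (Pi.single n 1) <| tendsto_const_nhds.congr' <| by
    filter_upwards [eventually_gt_atTop n] with m hm
    simp [hm.ne']

theorem unit_apply (n m : ℕ) : (unit n : SeqCZero 𝕜) m = if n = m then 1 else 0 := by
  simp [unit, Pi.single_apply, eq_comm]

theorem sum_smul_unit_apply (s : Finset ℕ) (b : ℕ → 𝕜) (m : ℕ) :
    (∑ n ∈ s, b n • (unit n : SeqCZero 𝕜)) m = if m ∈ s then b m else 0 := by
  have := map_sum (coord (𝕜 := 𝕜) m) (fun n => b n • (unit n : SeqCZero 𝕜)) s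
  rw [coord_apply] at this
  simp [this, unit_apply]

theorem norm_sum_smul_unit_le (s : Finset ℕ) (b : ℕ → 𝕜) {C : ℝ} (hC : 0 ≤ C)
    (hb : ∀ n, ‖b n‖ ≤ C) : ‖∑ n ∈ s, b n • (unit n : SeqCZero 𝕜)‖ ≤ C := by
  refine norm_le hC fun m => ?_
  rw [sum_smul_unit_apply]
  split_ifs
  · exact hb m
  · simpa using hC

theorem norm_unit (n : ℕ) : ‖(unit n : SeqCZero 𝕜)‖ = 1 := by
  refine le_antisymm (norm_le zero_le_one fun m => ?_) ?_
  · rw [unit_apply]; split_ifs <;> simp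
  · simpa [unit_apply] using norm_apply_le (unit n : SeqCZero 𝕜) n

theorem not_finiteDimensional : ¬ FiniteDimensional 𝕜 (SeqCZero 𝕜) :=
  not_finiteDimensional_of_biorthogonal unit (fun j => (coord j).toLinearMap)
    fun i j => unit_apply i j

/-- Bounded functionals are null along the unit vectors of `c₀`. -/
theorem tendsto_apply_unit (ψ : StrongDual 𝕜 (SeqCZero 𝕜)) :
    Tendsto (fun n => ψ (unit n)) atTop (𝓝 0) := by
  have hb : ∀ n, ‖ψ (unit n)‖ ≤ ‖ψ‖ := fun n => by
    simpa [norm_unit] using ψ.le_opNorm (unit n)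
  -- Testing `ψ` on $\sum \overline{\psi(e_n)}\, e_n$, of norm at most `‖ψ‖`, bounds the sum of
  -- squares by `‖ψ‖ * ‖ψ‖`; no division by phases is needed.
  have hsum : Summable fun n => ‖ψ (unit n)‖ ^ 2 := by
    refine summable_of_sum_le (c := ‖ψ‖ * ‖ψ‖) (fun n => by positivity) fun s => ?_
    have h1 := ψ.le_of_opNorm_le_of_le le_rfl (norm_sum_smul_unit_le s
      (fun n => star (ψ (unit n))) (norm_nonneg ψ) fun n => by simpa using hb n)
    have h2 : ψ (∑ n ∈ s, star (ψ (unit n)) • (unit n : SeqCZero 𝕜))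
        = ((∑ n ∈ s, ‖ψ (unit n)‖ ^ 2 : ℝ) : 𝕜) := by
      rw [map_sum]
      push_cast
      refine Finset.sum_congr rfl fun n _ => ?_
      rw [map_smul, smul_eq_mul, RCLike.star_def, RCLike.conj_mul]
    rw [h2, RCLike.norm_ofReal] at h1
    exact (le_abs_self _).trans h1
  have h0 := hsum.tendsto_atTop_zero
  rw [tendsto_zero_iff_norm_tendsto_zero]
  have := h0.sqrt
  simpa [Real.sqrt_sq] using this

end SeqCZero

theorem lp_one_norm_eq (v : lp (fun _ : ℕ => 𝕜) 1) : ‖v‖ = ∑' i, ‖v i‖ := by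
  simpa using lp.norm_eq_tsum_rpow (p := 1) (by simp) v

theorem lp_one_summable (v : lp (fun _ : ℕ => 𝕜) 1) : Summable fun i => ‖v i‖ := by
  simpa using (lp.memℓp v).summable (by simp)

/-- Coordinatewise null sequences in `ℓ¹` are asymptotically disjoint from any given vector. -/
theorem lp_one_eventually_norm_add_ge (v : lp (fun _ : ℕ => 𝕜) 1)
    (u : ℕ → lp (fun _ : ℕ => 𝕜) 1) (hu : ∀ i, Tendsto (fun n => u n i) atTop (𝓝 0))
    {ε : ℝ} (hε : 0 < ε) : ∀ᶠ n in atTop, ‖v‖ + ‖u n‖ - ε ≤ ‖v + u n‖ := by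
  -- `v` is small off `A` and `u n` is eventually small on `A`. Each of these two errors enters
  -- twice, hence `ε / 4`.
  obtain ⟨A, hA⟩ : ∃ A : Finset ℕ, ∑' i : {i // i ∉ A}, ‖v i‖ < ε / 4 :=
    ((tendsto_tsum_compl_atTop_zero fun i => ‖v i‖).eventually_lt_const
      (by positivity : (0 : ℝ) < ε / 4)).exists
  have hAu : Tendsto (fun n => ∑ i ∈ A, ‖u n i‖) atTop (𝓝 0) := by
    simpa using tendsto_finsetSum A fun i _ => (hu i).norm
  filter_upwards [hAu.eventually_lt_const (by positivity : (0 : ℝ) < ε / 4)] with n hn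
  have hv := lp_one_summable v
  have hun := lp_one_summable (u n)
  have hvu := lp_one_summable (v + u n)
  have split : ∀ w : lp (fun _ : ℕ => 𝕜) 1,
      ‖w‖ = ∑ i ∈ A, ‖w i‖ + ∑' i : {i // i ∉ A}, ‖w i‖ := fun w => by
    rw [lp_one_norm_eq]
    exact ((lp_one_summable w).sum_add_tsum_subtype_compl A).symm
  have hin : ∑ i ∈ A, ‖v i‖ - ∑ i ∈ A, ‖u n i‖ ≤ ∑ i ∈ A, ‖(v + u n) i‖ := by
    rw [← Finset.sum_sub_distrib]
    refine Finset.sum_le_sum fun i _ => ?_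
    simpa using norm_sub_le_norm_add (v i) (u n i)
  have hout : ∑' i : {i // i ∉ A}, ‖u n i‖ - ∑' i : {i // i ∉ A}, ‖v i‖
      ≤ ∑' i : {i // i ∉ A}, ‖(v + u n) i‖ := by
    have s1 := hun.subtype {i | i ∉ A}
    have s2 := hv.subtype {i | i ∉ A}
    have s3 := hvu.subtype {i | i ∉ A}
    refine le_trans (s1.tsum_sub s2).symm.le ((s1.sub s2).tsum_le_tsum (fun i => ?_) s3)
    have := norm_sub_le_norm_add (u n i.1) (v i.1)
    simpa [add_comm] using this
  rw [split v, split (u n), split (v + u n)]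
  linarith

/-- `c₀` does not embed into `ℓ¹`. -/
theorem not_exists_seqCZero_to_lp_one (S : SeqCZero 𝕜 →L[𝕜] lp (fun _ : ℕ => 𝕜) 1) {c : ℝ}
    (hc : 0 < c) (hS : ∀ a, c * ‖a‖ ≤ ‖S a‖) : False := by
  have hnull : ∀ i, Tendsto (fun n => S (SeqCZero.unit n) i) atTop (𝓝 0) := fun i => by
    let ψ : StrongDual 𝕜 (SeqCZero 𝕜) :=
      LinearMap.mkContinuous
        { toFun := fun a => S a i, map_add' := fun a b => by simp,
          map_smul' := fun r a => by simp } ‖S‖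
        fun a => (lp.norm_apply_le_norm (by simp) (S a) i).trans (S.le_opNorm a)
    exact SeqCZero.tendsto_apply_unit ψ
  -- Each new unit vector has an image of norm at least `c`, almost disjoint from the current sum up
  -- to a loss of `c / 2`. The image norms grow without bound, while sums of distinct unit vectors
  -- stay in the unit ball of $c_0$.
  have grow : ∀ K : ℕ, ∃ s : Finset ℕ,
      K * (c / 2) ≤ ‖S (∑ n ∈ s, (1 : 𝕜) • (SeqCZero.unit n : SeqCZero 𝕜))‖ := by
    intro K
    induction K with
    | zero => exact ⟨∅, by simp⟩
    | succ K ih =>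
      obtain ⟨s, hs⟩ := ih
      obtain ⟨n, hn, hns⟩ := ((lp_one_eventually_norm_add_ge
        (S (∑ n ∈ s, (1 : 𝕜) • (SeqCZero.unit n : SeqCZero 𝕜))) _ hnull (half_pos hc)).and
          (Nat.cofinite_eq_atTop ▸ s.finite_toSet.compl_mem_cofinite)).exists
      refine ⟨insert n s, ?_⟩
      rw [Finset.sum_insert (by simpa using hns), add_comm, map_add, one_smul]
      have := hS (SeqCZero.unit n)
      rw [SeqCZero.norm_unit] at this
      rw [add_comm (S _)]
      push_cast
      linarith
  obtain ⟨K, hK⟩ := exists_nat_gt (‖S‖ / (c / 2))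
  obtain ⟨s, hs⟩ := grow K
  have h1 := S.le_of_opNorm_le_of_le le_rfl (SeqCZero.norm_sum_smul_unit_le s
      (fun _ => (1 : 𝕜)) zero_le_one fun n => by simp)
  rw [div_lt_iff₀ (by positivity)] at hK
  linarith

theorem not_finiteDimensional_lp_one : ¬ FiniteDimensional 𝕜 (lp (fun _ : ℕ => 𝕜) 1) :=
  not_finiteDimensional_of_biorthogonal (fun i => lp.single 1 i (1 : 𝕜))
    (fun j => { toFun := fun v => v j, map_add' := fun _ _ => rfl, map_smul' := fun _ _ => rfl })
    fun i j => by
      change lp.single (E := fun _ : ℕ => 𝕜) 1 i (1 : 𝕜) j = _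
      rw [lp.single_apply, Pi.single_apply]
      simp only [eq_comm]

end SequenceSpaces

/-! ### Minimal positive oscillation produces $\ell^1$ -/

section Splitting

variable {𝕜 : Type*} [RCLike 𝕜] {X : Type*} [NormedAddCommGroup X] [NormedSpace 𝕜 X]

/-- If no convex tail of `g` oscillates less than `g` does, then finitely many reindexings of `g`
can be split simultaneously by one vector. -/
theorem exists_splitting {g : ℕ → StrongDual 𝕜 X} {C δ : ℝ} (hg : ∀ n, ‖g n‖ ≤ C) (hδ : 0 < δ)
    (hosc : ∀ d > δ, OscLE g d) (hmin : ∀ h, IsConvexTail h g → ∀ d < δ, ¬ OscLE h d)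
    (T : Finset (ℕ → ℕ)) (hT : T.Nonempty) (hψ : ∀ ψ ∈ T, Tendsto ψ atTop atTop)
    {ε : ℝ} (hε : 0 < ε) :
    ∃ (x : X) (z : Bool → 𝕜) (φ : Bool → ℕ → ℕ), ‖x‖ ≤ 1 ∧ δ / 2 ≤ ‖z true - z false‖ ∧
      (∀ b, Tendsto (φ b) atTop atTop) ∧
      ∀ ψ ∈ T, ∀ b n, ‖g (ψ (φ b n)) x - z b‖ ≤ ε := by
  have hcard : (0 : ℝ) < T.card := by exact_mod_cast hT.card_pos
  -- Since $(\delta+\eta)^2 - (\delta-\eta)^2 = 4\delta\eta$, the bound needed is $\eta \le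
  -- \varepsilon^2/(16|T|\delta)$.
  obtain ⟨η, hη0, hηδ, hηε⟩ : ∃ η > 0, η ≤ δ / 2 ∧
      T.card * ((δ + η) ^ 2 - (δ - η) ^ 2) ≤ (ε / 2) ^ 2 := by
    refine ⟨min (δ / 2) (ε ^ 2 / (16 * T.card * δ)), by positivity, min_le_left _ _, ?_⟩
    have h := min_le_right (δ / 2) (ε ^ 2 / (16 * T.card * δ))
    rw [le_div_iff₀ (by positivity)] at h
    nlinarith
  set h : ℕ → StrongDual 𝕜 X := fun n => ∑ ψ ∈ T, (T.card : ℝ)⁻¹ • g (ψ n) with hh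
  have hht : IsConvexTail h g := IsConvexTail.average g T hT hψ
  have hnot := hmin h hht (δ - η) (by linarith)
  simp only [OscLE, not_forall, not_exists, not_le] at hnot
  obtain ⟨x, hx, hfreq⟩ := hnot
  choose n hn m hm hnm using hfreq
  obtain ⟨N, hN⟩ := (hosc (δ + η) (by linarith)).exists_convexHull hx
  have hnt : Tendsto n atTop atTop := tendsto_atTop_mono hn tendsto_id
  have hmt : Tendsto m atTop atTop := tendsto_atTop_mono hm tendsto_id
  have hsum : ∀ k, ∑ ψ ∈ T, g (ψ k) x = T.card * h k x := fun k => by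
    have h0 : (T.card : 𝕜) ≠ 0 := by exact_mod_cast hcard.ne'
    simp only [hh, sum_apply, smul_apply,
      ← Finset.smul_sum, RCLike.real_smul_eq_coe_mul]
    push_cast
    rw [mul_inv_cancel_left₀ h0]
  -- The differences `g (χ a) x - h b x` have norm at most `δ + η` and their average has norm at
  -- least `δ - η`, so the variance estimate puts each close to the average.
  have near : ∀ a b, δ - η ≤ ‖h a x - h b x‖ → h b ∈ convexHull ℝ (g '' Set.Ici N) →
      ∀ ψ ∈ T, (∀ χ ∈ T, N ≤ χ a) → ‖g (ψ a) x - h a x‖ ≤ ε / 2 := by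
    intro a b hab hb ψ hψT hNa
    have := norm_sub_average_sq_le T (fun χ => g (χ a) x - h b x) (h a x - h b x)
      (d := δ + η) (e := δ - η) (by simp [Finset.sum_sub_distrib, hsum, mul_sub])
      (fun χ hχ => hN _ (subset_convexHull ℝ _ ⟨_, hNa χ hχ, rfl⟩) _ hb) (by linarith) hab hψT
    rw [sub_sub_sub_cancel_right] at this
    exact (sq_le_sq₀ (norm_nonneg _) (by positivity)).1 (this.trans hηε)
  have hbd : ∀ k, ‖h k x‖ ≤ C := fun k => by
    have h1 : T.card * ‖h k x‖ ≤ T.card * C := by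
      calc T.card * ‖h k x‖ = ‖∑ ψ ∈ T, g (ψ k) x‖ := by rw [hsum]; simp
        _ ≤ ∑ ψ ∈ T, C := norm_sum_le_of_le _ fun ψ _ =>
            ((g (ψ k)).le_of_opNorm_le_of_le (hg _) hx).trans_eq (mul_one C)
        _ = T.card * C := by simp
    exact le_of_mul_le_mul_left h1 hcard
  obtain ⟨Z, -, α, hα, hZ⟩ := tendsto_subseq_of_bounded
    (Metric.isBounded_closedBall (x := (0 : 𝕜)) (r := C)) (x := fun k => h (n k) x)
    fun k => by simpa using hbd (n k)
  obtain ⟨W, -, β, hβ, hW⟩ := tendsto_subseq_of_bounded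
    (Metric.isBounded_closedBall (x := (0 : 𝕜)) (r := C)) (x := fun k => h (m (α k)) x)
    fun k => by simpa using hbd (m (α k))
  have hγ : Tendsto (fun k => α (β k)) atTop atTop := hα.tendsto_atTop.comp hβ.tendsto_atTop
  have hZ' : Tendsto (fun k => h (n (α (β k))) x) atTop (𝓝 Z) := hZ.comp hβ.tendsto_atTop
  have hW' : Tendsto (fun k => h (m (α (β k))) x) atTop (𝓝 W) := hW
  have far : ∀ {p : ℕ → ℕ}, Tendsto p atTop atTop → ∀ᶠ k in atTop,
      h (p k) ∈ convexHull ℝ (g '' Set.Ici N) ∧ ∀ χ ∈ T, N ≤ χ (p k) := fun hp =>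
    hp.eventually ((hht N).and
      ((eventually_all_finset T).2 fun χ hχ => (hψ χ hχ).eventually_ge_atTop N))
  have close : ∀ {p : ℕ → ℕ} {c : 𝕜}, Tendsto (fun k => h (p k) x) atTop (𝓝 c) →
      ∀ᶠ k in atTop, ‖h (p k) x - c‖ ≤ ε / 2 := fun hp =>
    (tendsto_iff_norm_sub_tendsto_zero.1 hp).eventually_le_const (by positivity)
  obtain ⟨K, hK⟩ := eventually_atTop.1 ((far (hnt.comp hγ)).and ((far (hmt.comp hγ)).and
    ((close hZ').and (close hW'))))
  refine ⟨x, fun b => bif b then Z else W,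
    fun b k => bif b then n (α (β (k + K))) else m (α (β (k + K))), hx, ?_, ?_, ?_⟩
  · refine ge_of_tendsto (hZ'.sub hW').norm (Eventually.of_forall fun k => ?_)
    linarith [hnm (α (β k))]
  · have hshift := hγ.comp (tendsto_add_atTop_nat K)
    rintro (_ | _)
    · exact hmt.comp hshift
    · exact hnt.comp hshift
  · intro ψ hψT b k
    obtain ⟨⟨hn1, hn2⟩, ⟨hm1, hm2⟩, hc1, hc2⟩ := hK (k + K) (Nat.le_add_left _ _)
    have hgap := (hnm (α (β (k + K)))).le
    cases b
    · have h1 := near _ _ (by rwa [norm_sub_rev]) hn1 ψ hψT hm2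
      exact (norm_sub_le_norm_sub_add_norm_sub _ _ _).trans
        ((add_le_add h1 hc2).trans_eq (add_halves ε))
    · have h1 := near _ _ hgap hm1 ψ hψT hn2
      exact (norm_sub_le_norm_sub_add_norm_sub _ _ _).trans
        ((add_le_add h1 hc1).trans_eq (add_halves ε))

/-- A sequence of functionals with minimal positive oscillation produces a Boolean independent
sequence of vectors. -/
theorem exists_boolean_independent {g : ℕ → StrongDual 𝕜 X} {C δ : ℝ} (hg : ∀ n, ‖g n‖ ≤ C)
    (hδ : 0 < δ) (hosc : ∀ d > δ, OscLE g d)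
    (hmin : ∀ h, IsConvexTail h g → ∀ d < δ, ¬ OscLE h d) {ε : ℝ} (hε : 0 < ε) :
    ∃ (x : ℕ → X) (z : ℕ → Bool → 𝕜), (∀ k, ‖x k‖ ≤ 1) ∧
      (∀ k, δ / 2 ≤ ‖z k true - z k false‖) ∧
      ∀ (σ : ℕ → Bool) (m : ℕ), ∃ j, ∀ k < m, ‖g j (x k) - z k (σ k)‖ ≤ ε := by
  classical
  let State := {T : Finset (ℕ → ℕ) // T.Nonempty ∧ ∀ ψ ∈ T, Tendsto ψ atTop atTop}
  have step := fun T : State => exists_splitting hg hδ hosc hmin T.1 T.2.1 T.2.2 hε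
  choose x z φ hx hz hφ hclose using step
  -- Each reindexing is refined along both branches, and the next vector must split all refinements
  -- at once.
  let next : State → State := fun T =>
    ⟨(T.1 ×ˢ Finset.univ).image fun p => p.1 ∘ φ T p.2,
      (T.2.1.product Finset.univ_nonempty).image _, by
        simp only [Finset.mem_image, Finset.mem_product]
        rintro _ ⟨p, ⟨hp, -⟩, rfl⟩
        exact (T.2.2 _ hp).comp (hφ T p.2)⟩
  let T0 : State := ⟨{id}, Finset.singleton_nonempty _, by
    intro ψ hψ
    rw [Finset.mem_singleton.1 hψ]
    exact tendsto_id⟩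
  let T : ℕ → State := fun k => next^[k] T0
  have hTs : ∀ k, T (k + 1) = next (T k) := fun k => Function.iterate_succ_apply' next k T0
  refine ⟨fun k => x (T k), fun k => z (T k), fun k => hx _, fun k => hz _, fun σ m => ?_⟩
  let H : ℕ → ℕ → ℕ := fun k => Nat.rec id (fun k ψ => ψ ∘ φ (T k) (σ k)) k
  have hHT : ∀ k, H k ∈ (T k).1 := fun k => by
    induction k with
    | zero => exact Finset.mem_singleton_self _
    | succ k ih =>
      rw [hTs]
      exact Finset.mem_image.2
        ⟨(H k, σ k), Finset.mem_product.2 ⟨ih, Finset.mem_univ _⟩, rfl⟩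
  have hfac : ∀ k m, k ≤ m → ∀ n, ∃ n', H m n = H k n' := by
    intro k m hkm
    induction m, hkm using Nat.le_induction with
    | base => exact fun n => ⟨n, rfl⟩
    | succ m _ ih => exact fun n => ih (φ (T m) (σ m) n)
  refine ⟨H m 0, fun k hk => ?_⟩
  -- The choice `σ k` is made in passing from `H k` to `H (k + 1)`; later stages only refine it.
  obtain ⟨n', hn'⟩ := hfac (k + 1) m hk 0
  rw [hn']
  exact hclose (T k) (H k) (hHT k) (σ k) n'

/-- Use the signs of the real parts or of the imaginary parts, whichever have the larger absolute
sum; this costs the factor `2`. -/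
theorem exists_signs_sum_norm_le (s : Finset ℕ) (b : ℕ → 𝕜) :
    ∃ σ : ℕ → Bool, ∑ k ∈ s, ‖b k‖ ≤ 2 * ‖∑ k ∈ s, bif σ k then b k else -b k‖ := by
  have key : ∀ L : 𝕜 →ₗ[ℝ] ℝ, (∀ w, |L w| ≤ ‖w‖) → ∃ σ : ℕ → Bool,
      ∑ k ∈ s, |L (b k)| ≤ ‖∑ k ∈ s, bif σ k then b k else -b k‖ := by
    intro L hL
    refine ⟨fun k => decide (0 ≤ L (b k)), le_trans ?_ ((le_abs_self _).trans (hL _))⟩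
    rw [map_sum]
    refine Finset.sum_le_sum fun k _ => ?_
    by_cases hk : 0 ≤ L (b k)
    · simp [hk, abs_of_nonneg hk]
    · simp [hk, abs_of_neg (not_le.1 hk)]
  obtain ⟨σ, hσ⟩ := key RCLike.reLm RCLike.abs_re_le_norm
  obtain ⟨τ, hτ⟩ := key RCLike.imLm RCLike.abs_im_le_norm
  have hsum : ∑ k ∈ s, ‖b k‖ ≤ ∑ k ∈ s, |RCLike.re (b k)| + ∑ k ∈ s, |RCLike.im (b k)| := by
    rw [← Finset.sum_add_distrib]
    refine Finset.sum_le_sum fun k _ => ?_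
    conv_lhs => rw [← RCLike.re_add_im (b k)]
    refine (norm_add_le _ _).trans ?_
    rw [norm_mul, RCLike.norm_ofReal, RCLike.norm_ofReal]
    gcongr
    exact mul_le_of_le_one_right (abs_nonneg _) (by rw [RCLike.norm_I]; split_ifs <;> simp)
  simp only [RCLike.reLm_coe, RCLike.imLm_coe] at hσ hτ
  rcases le_total (∑ k ∈ s, |RCLike.re (b k)|) (∑ k ∈ s, |RCLike.im (b k)|) with h | h
  · exact ⟨τ, by linarith⟩
  · exact ⟨σ, by linarith⟩

/-- A sequence of functionals with minimal positive oscillation produces a sequence of vectors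
equivalent to the unit vector basis of `ℓ¹`. -/
theorem exists_lower_l1_estimate {g : ℕ → StrongDual 𝕜 X} {C δ : ℝ} (hg : ∀ n, ‖g n‖ ≤ C)
    (hδ : 0 < δ) (hosc : ∀ d > δ, OscLE g d)
    (hmin : ∀ h, IsConvexTail h g → ∀ d < δ, ¬ OscLE h d) :
    ∃ x : ℕ → X, (∀ k, ‖x k‖ ≤ 1) ∧ ∃ c > 0, ∀ (m : ℕ) (a : ℕ → 𝕜),
      c * ∑ k ∈ Finset.range m, ‖a k‖ ≤ ‖∑ k ∈ Finset.range m, a k • x k‖ := by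
  obtain ⟨x, z, hx, hz, hind⟩ :=
    exists_boolean_independent hg hδ hosc hmin (by positivity : 0 < δ / 16)
  have hC : 0 ≤ C := (norm_nonneg _).trans (hg 0)
  -- With $A = \sum |a_k|$, opposite branches give $\frac{\delta}{2} A \le 2(2C\|y\| +
  -- \frac{\delta}{8} A)$, that is $\delta A \le 16 C \|y\|$. The `+ 1` keeps the denominator
  -- positive.
  refine ⟨x, hx, δ / (16 * (C + 1)), by positivity, fun m a => ?_⟩
  set y := ∑ k ∈ Finset.range m, a k • x k with hy
  obtain ⟨σ, hσ⟩ := exists_signs_sum_norm_le (Finset.range m)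
    fun k => a k * (z k true - z k false)
  obtain ⟨i, hi⟩ := hind σ m
  obtain ⟨j, hj⟩ := hind (fun k => !σ k) m
  have hup : ‖g i y - g j y‖ ≤ 2 * C * ‖y‖ := by
    have h1 := (g i).le_of_opNorm_le (hg i) y
    have h2 := (g j).le_of_opNorm_le (hg j) y
    linarith [norm_sub_le (g i y) (g j y)]
  have herr : ‖(∑ k ∈ Finset.range m, bif σ k then a k * (z k true - z k false)
      else -(a k * (z k true - z k false))) - (g i y - g j y)‖
      ≤ ∑ k ∈ Finset.range m, ‖a k‖ * (δ / 8) := by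
    rw [hy, map_sum, map_sum, ← Finset.sum_sub_distrib, ← Finset.sum_sub_distrib]
    refine norm_sum_le_of_le _ fun k hk => ?_
    have h1 := hi k (Finset.mem_range.1 hk)
    have h2 := hj k (Finset.mem_range.1 hk)
    have h3 : (bif σ k then a k * (z k true - z k false) else -(a k * (z k true - z k false)))
        - (g i (a k • x k) - g j (a k • x k))
        = a k * ((g j (x k) - z k (!σ k)) - (g i (x k) - z k (σ k))) := by
      rw [map_smul, map_smul, smul_eq_mul, smul_eq_mul]
      cases σ k <;> simp <;> ring
    rw [h3, norm_mul]
    gcongr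
    exact (norm_sub_le _ _).trans (by linarith)
  have hlow : δ / 2 * ∑ k ∈ Finset.range m, ‖a k‖
      ≤ ∑ k ∈ Finset.range m, ‖a k * (z k true - z k false)‖ := by
    rw [Finset.mul_sum]
    refine Finset.sum_le_sum fun k _ => ?_
    rw [norm_mul, mul_comm]
    exact mul_le_mul_of_nonneg_left (hz k) (norm_nonneg _)
  rw [← Finset.sum_mul] at herr
  have htri := norm_sub_norm_le (∑ k ∈ Finset.range m, bif σ k then a k * (z k true - z k false)
      else -(a k * (z k true - z k false))) (g i y - g j y)
  rw [div_mul_eq_mul_div, div_le_iff₀ (by positivity)]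
  nlinarith [norm_nonneg y]

/-- A bounded sequence with a lower `ℓ¹` estimate spans a copy of `ℓ¹`. -/
theorem exists_lp_one_embedding [CompleteSpace X] {x : ℕ → X} (hx : ∀ k, ‖x k‖ ≤ 1) {c : ℝ}
    (hlow : ∀ (m : ℕ) (a : ℕ → 𝕜),
      c * ∑ k ∈ Finset.range m, ‖a k‖ ≤ ‖∑ k ∈ Finset.range m, a k • x k‖) :
    ∃ S : lp (fun _ : ℕ => 𝕜) 1 →L[𝕜] X, ∀ a, c * ‖a‖ ≤ ‖S a‖ := by
  have hterm : ∀ (a : lp (fun _ : ℕ => 𝕜) 1) k, ‖a k • x k‖ ≤ ‖a k‖ := fun a k => by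
    rw [norm_smul]
    exact mul_le_of_le_one_right (norm_nonneg _) (hx k)
  have hsum : ∀ a : lp (fun _ : ℕ => 𝕜) 1, Summable fun k => a k • x k := fun a =>
    (lp_one_summable a).of_norm_bounded (hterm a)
  let S : lp (fun _ : ℕ => 𝕜) 1 →ₗ[𝕜] X :=
    { toFun := fun a => ∑' k, a k • x k
      map_add' := fun a b => by
        simp only [lp.coeFn_add, Pi.add_apply, add_smul]
        exact (hsum a).tsum_add (hsum b)
      map_smul' := fun r a => by
        simp only [lp.coeFn_smul, Pi.smul_apply, smul_assoc, RingHom.id_apply]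
        exact (hsum a).tsum_const_smul r }
  refine ⟨S.mkContinuous 1 fun a => ?_, fun a => ?_⟩
  · rw [one_mul, lp_one_norm_eq]
    exact tsum_of_norm_bounded (lp_one_summable a).hasSum (hterm a)
  · rw [lp_one_norm_eq]
    exact le_of_tendsto_of_tendsto'
      ((lp_one_summable a).hasSum.tendsto_sum_nat.const_mul c)
      (hsum a).hasSum.tendsto_sum_nat.norm fun m => hlow m a

/-- Hereditarily `c₀` Banach spaces contain no copy of `ℓ¹`. -/
theorem IsHereditarily.not_lp_one_embedding [CompleteSpace X]
    (hX : IsHereditarily 𝕜 (SeqCZero 𝕜) X) (S : lp (fun _ : ℕ => 𝕜) 1 →L[𝕜] X) {c : ℝ}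
    (hc : 0 < c) (hS : ∀ a, c * ‖a‖ ≤ ‖S a‖) : False := by
  have hanti : AntilipschitzWith (Real.toNNReal c⁻¹) S :=
    ContinuousLinearMap.antilipschitz_of_bound S fun a => by
      rw [Real.coe_toNNReal _ (by positivity), inv_mul_eq_div, le_div_iff₀ hc, mul_comm]
      exact hS a
  have hclosed : IsClosed (Set.range S) := hanti.isClosed_range S.uniformContinuous
  let e := S.equivRange hanti.injective hclosed
  obtain ⟨N, hN, -, ⟨Φ⟩⟩ := hX S.range hclosed fun hfin =>
    not_finiteDimensional_lp_one (e.symm.toLinearEquiv.finiteDimensional)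
  let J : SeqCZero 𝕜 →L[𝕜] S.range :=
    (N.subtypeL.comp Φ.symm.toContinuousLinearMap).codRestrict S.range
      fun a => hN (Φ.symm a).2
  -- The copy of $c_0$ inside the range of `S`, pulled back to $\ell^1$.
  let R : SeqCZero 𝕜 →L[𝕜] lp (fun _ : ℕ => 𝕜) 1 := e.symm.toContinuousLinearMap.comp J
  have hR : ∀ a, ‖a‖ ≤ ‖Φ.toContinuousLinearMap‖ * ‖S‖ * ‖R a‖ := fun a => by
    have h1 : S (R a) = (Φ.symm a : X) := congrArg Subtype.val (e.apply_symm_apply (J a))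
    calc ‖a‖ = ‖Φ.toContinuousLinearMap (Φ.symm a)‖ := by simp
      _ ≤ ‖Φ.toContinuousLinearMap‖ * ‖(Φ.symm a : X)‖ :=
        Φ.toContinuousLinearMap.le_opNorm (Φ.symm a)
      _ = ‖Φ.toContinuousLinearMap‖ * ‖S (R a)‖ := by rw [h1]
      _ ≤ _ := by
        rw [mul_assoc]
        gcongr
        exact S.le_opNorm _
  refine not_exists_seqCZero_to_lp_one R (c := (‖Φ.toContinuousLinearMap‖ * ‖S‖ + 1)⁻¹)
    (by positivity) fun a => ?_
  rw [inv_mul_le_iff₀ (by positivity)]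
  nlinarith [hR a, norm_nonneg (R a)]

end Splitting

/-! ### From a weak* Cauchy convex tail to a projection -/

section Projection

variable {𝕜 : Type*} [RCLike 𝕜] {X : Type*} [NormedAddCommGroup X] [NormedSpace 𝕜 X]

theorem OscLE.tendsto_sub {g : ℕ → StrongDual 𝕜 X} (h : ∀ d > 0, OscLE g d) {p q : ℕ → ℕ}
    (hp : Tendsto p atTop atTop) (hq : Tendsto q atTop atTop) (x : X) :
    Tendsto (fun k => g (p k) x - g (q k) x) atTop (𝓝 0) := by
  rw [Metric.tendsto_atTop']
  intro ε hε
  have hr : 0 < ‖x‖ + 1 := by positivity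
  -- `OscLE` only tests the unit ball; scaling by `‖x‖ + 1` also covers `x = 0`.
  set y : X := ((‖x‖ + 1 : ℝ) : 𝕜)⁻¹ • x with hy
  have hy1 : ‖y‖ ≤ 1 := by
    rw [hy, norm_smul, norm_inv, RCLike.norm_ofReal, abs_of_pos hr, inv_mul_le_iff₀ hr]
    linarith
  have hxy : x = ((‖x‖ + 1 : ℝ) : 𝕜) • y := by
    rw [hy, smul_inv_smul₀]
    exact_mod_cast hr.ne'
  obtain ⟨N, hN⟩ := h (ε / 2 / (‖x‖ + 1)) (by positivity) y hy1
  obtain ⟨K, hK⟩ := eventually_atTop.1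
    ((hp.eventually_ge_atTop N).and (hq.eventually_ge_atTop N))
  refine ⟨K, fun k hk => ?_⟩
  have h1 := hN _ (hK k hk.le).1 _ (hK k hk.le).2
  rw [le_div_iff₀ hr] at h1
  rw [dist_zero_right]
  have h2 : g (p k) x - g (q k) x = ((‖x‖ + 1 : ℝ) : 𝕜) * (g (p k) y - g (q k) y) := by
    have h3 : ∀ u : StrongDual 𝕜 X, u x = ((‖x‖ + 1 : ℝ) : 𝕜) * u y := fun u =>
      (congrArg u hxy).trans (u.map_smul _ _)
    rw [h3 (g (p k)), h3 (g (q k)), mul_sub]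
  rw [h2, norm_mul, RCLike.norm_ofReal, abs_of_pos hr]
  linarith

/-- Successive blocks of indices carrying convex combinations of a sequence. -/
theorem IsConvexTail.exists_blocks {E : Type*} [AddCommGroup E] [Module ℝ E] {f g : ℕ → E}
    (h : IsConvexTail g f) :
    ∃ κ p : ℕ → ℕ, Tendsto κ atTop atTop ∧ Tendsto p atTop atTop ∧
      ∀ k, g (p k) ∈ convexHull ℝ (f '' {i | κ i = k}) := by
  choose M n hM hn hg using h.exists_mem_convexHull_Ico
  let I : ℕ → ℕ := fun k => M^[k] 0
  have hIs : ∀ k, I (k + 1) = M (I k) := fun k => Function.iterate_succ_apply' M k 0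
  have hI : StrictMono I := strictMono_nat_of_lt_succ fun k => by
    rw [hIs]
    exact hM _
  -- The number of the block containing `i`. Searching up to `i` suffices as `k ≤ I k`, and the
  -- default `0` is correct as `I 0 = 0`.
  let κ : ℕ → ℕ := fun i => Nat.findGreatest (fun k => I k ≤ i) i
  have hle : ∀ k i, I k ≤ i → k ≤ κ i := fun k i hk =>
    Nat.le_findGreatest ((hI.le_apply).trans hk) hk
  refine ⟨κ, fun k => n (I k), tendsto_atTop.2 fun k => ?_,
    tendsto_atTop_mono (fun k => (hI.le_apply).trans (hn (I k))) tendsto_id, fun k => ?_⟩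
  · filter_upwards [eventually_ge_atTop (I k)] with i hi using hle k i hi
  · refine convexHull_mono (Set.image_mono ?_) (hg (I k))
    rintro i ⟨h1, h2⟩
    refine le_antisymm (Nat.lt_succ_iff.1 (hI.lt_iff_lt.1 ?_)) (hle k i h1)
    have h3 : I (κ i) ≤ i := Nat.findGreatest_spec (P := fun k => I k ≤ i) (Nat.zero_le i)
      (Nat.zero_le i)
    rw [Nat.succ_eq_add_one, hIs]
    exact h3.trans_lt h2

/-- The operator on `c₀` repeating the `k`-th coordinate along the block `κ = 2 * k`. -/
theorem SeqCZero.exists_spread {κ : ℕ → ℕ} (hκ : Tendsto κ atTop atTop) :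
    ∃ B : SeqCZero 𝕜 →L[𝕜] SeqCZero 𝕜,
      ∀ a i, B a i = if Even (κ i) then a (κ i / 2) else 0 := by
  have hnull : ∀ a : SeqCZero 𝕜,
      Tendsto (fun i => if Even (κ i) then a (κ i / 2) else 0) atTop (𝓝 0) := fun a => by
    have h1 : Tendsto (fun i => ‖a (κ i / 2)‖) atTop (𝓝 0) := by
      simpa using ((SeqCZero.tendsto a).comp
        ((Nat.tendsto_div_const_atTop two_ne_zero).comp hκ)).norm
    refine squeeze_zero_norm (fun i => ?_) h1
    split_ifs <;> simp
  let B : SeqCZero 𝕜 →ₗ[𝕜] SeqCZero 𝕜 :=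
    { toFun := fun a => ofTendsto _ (hnull a)
      map_add' := fun a b => by
        ext i
        simp only [ofTendsto_apply, ZeroAtInftyContinuousMap.add_apply]
        split_ifs <;> simp
      map_smul' := fun r a => by
        ext i
        simp only [ofTendsto_apply, ZeroAtInftyContinuousMap.smul_apply, RingHom.id_apply]
        split_ifs <;> simp }
  refine ⟨B.mkContinuous 1 fun a => norm_le (by positivity) fun i => ?_, fun a i => rfl⟩
  rw [one_mul]
  change ‖if Even (κ i) then a (κ i / 2) else 0‖ ≤ ‖a‖
  split_ifs
  · exact norm_apply_le a _
  · simp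

/-- A pointwise null bounded sequence of functionals is an operator into `c₀`. -/
theorem SeqCZero.exists_operator {G : ℕ → StrongDual 𝕜 X} {C : ℝ} (hG : ∀ k, ‖G k‖ ≤ C)
    (hnull : ∀ x, Tendsto (fun k => G k x) atTop (𝓝 0)) :
    ∃ Q : X →L[𝕜] SeqCZero 𝕜, ∀ x k, Q x k = G k x := by
  let Q : X →ₗ[𝕜] SeqCZero 𝕜 :=
    { toFun := fun x => ofTendsto _ (hnull x)
      map_add' := fun x y => by ext k; simp
      map_smul' := fun r x => by ext k; simp }
  have hC : 0 ≤ C := (norm_nonneg _).trans (hG 0)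
  exact ⟨Q.mkContinuous C fun x => norm_le (by positivity)
    fun k => (G k).le_of_opNorm_le (hG k) x, fun x k => rfl⟩

/-- If the coordinate functionals of a copy of `c₀` extend to a bounded sequence with a pointwise
Cauchy convex tail, then the copy contains a complemented copy of `c₀`. -/
theorem exists_complemented_of_convexTail {J : SeqCZero 𝕜 →L[𝕜] X} {f g : ℕ → StrongDual 𝕜 X}
    (hf : ∀ i b, f i (J b) = b i) {C : ℝ} (hg : ∀ n, ‖g n‖ ≤ C) (hgf : IsConvexTail g f)
    (hosc : ∀ d > 0, OscLE g d) :
    ∃ (V : SeqCZero 𝕜 →L[𝕜] X) (Q : X →L[𝕜] SeqCZero 𝕜),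
      (∀ a, V a ∈ J.range) ∧ ∀ a, Q (V a) = a := by
  obtain ⟨κ, p, hκ, hp, hgp⟩ := hgf.exists_blocks
  obtain ⟨B, hB⟩ := SeqCZero.exists_spread (𝕜 := 𝕜) hκ
  have heven : Tendsto (fun k => p (2 * k)) atTop atTop :=
    hp.comp (tendsto_atTop_mono (fun k => by simp only [id]; omega) tendsto_id)
  have hodd : Tendsto (fun k => p (2 * k + 1)) atTop atTop :=
    hp.comp (tendsto_atTop_mono (fun k => by simp only [id]; omega) tendsto_id)
  obtain ⟨Q, hQ⟩ := SeqCZero.exists_operator (G := fun k => g (p (2 * k)) - g (p (2 * k + 1)))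
    (C := C + C) (fun k => norm_sub_le_of_le (hg _) (hg _))
    fun x => OscLE.tendsto_sub hosc heven hodd x
  refine ⟨J.comp B, Q, fun a => ⟨B a, rfl⟩, fun a => ?_⟩
  -- All `f i` of one block agree at `J (B a)`, so their convex combination takes the same value.
  have hval : ∀ k c, (∀ i, κ i = k → B a i = c) → g (p k) (J (B a)) = c := by
    intro k c hc
    have : ∀ u ∈ f '' {i | κ i = k}, ∀ v ∈ f '' {i | κ i = k},
        ‖u (J (B a)) - v (J (B a))‖ ≤ 0 := by
      rintro _ ⟨i, hi, rfl⟩ _ ⟨j, hj, rfl⟩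
      simp [hf, hc i hi, hc j hj]
    obtain ⟨_, i, hi, rfl⟩ := convexHull_nonempty_iff.1 ⟨_, hgp k⟩
    have h0 := norm_apply_sub_apply_le_of_mem_convexHull this (hgp k)
      (subset_convexHull ℝ _ ⟨i, hi, rfl⟩)
    rw [sub_eq_zero.1 (norm_le_zero_iff.1 h0), hf, hc i hi]
  ext k
  have h1 := hval (2 * k) (a k) fun i hi => by simp [hB, hi]
  have h2 := hval (2 * k + 1) 0 fun i hi => by simp [hB, hi]
  rw [hQ]
  change g (p (2 * k)) (J (B a)) - g (p (2 * k + 1)) (J (B a)) = a k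
  rw [h1, h2, sub_zero]

/-- In a hereditarily `c₀` Banach space every bounded sequence of functionals has a bounded convex
tail that is pointwise Cauchy. -/
theorem IsHereditarily.exists_cauchy_convexTail [CompleteSpace X]
    (hX : IsHereditarily 𝕜 (SeqCZero 𝕜) X) {f : ℕ → StrongDual 𝕜 X} {C : ℝ}
    (hf : ∀ n, ‖f n‖ ≤ C) :
    ∃ g, IsConvexTail g f ∧ (∀ n, ‖g n‖ ≤ C) ∧ ∀ d > 0, OscLE g d := by
  obtain ⟨g₀, hg₀, δ, hδ, hosc, hmin⟩ := exists_isConvexTail_osc_minimal (oscLE_of_norm_le hf)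
  obtain ⟨K, hK⟩ := eventually_atTop.1 (hg₀ 0)
  -- The first terms of `g₀` need not lie in the hull of the `f n`; dropping them gives the bound
  -- `C` for every term.
  let g : ℕ → StrongDual 𝕜 X := fun n => g₀ (n + K)
  have hgg₀ : IsConvexTail g g₀ := fun N =>
    (tendsto_add_atTop_nat K).eventually (IsConvexTail.refl g₀ N)
  have hgC : ∀ n, ‖g n‖ ≤ C := fun n => by
    have hball : convexHull ℝ (f '' Set.Ici 0) ⊆ Metric.closedBall 0 C :=
      convexHull_min (by rintro _ ⟨i, -, rfl⟩; simpa using hf i) (convex_closedBall 0 C)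
    simpa using hball (hK (n + K) (Nat.le_add_left _ _))
  have hosc' : ∀ d > δ, OscLE g d := fun d hd => (hosc d hd).of_isConvexTail hgg₀
  rcases hδ.eq_or_lt with rfl | hpos
  · exact ⟨g, hgg₀.trans hg₀, hgC, hosc'⟩
  · obtain ⟨x, hx, c, hc, hlow⟩ :=
      exists_lower_l1_estimate hgC hpos hosc' fun h hh => hmin h (hh.trans hgg₀)
    obtain ⟨S, hS⟩ := exists_lp_one_embedding hx hlow
    exact (hX.not_lp_one_embedding S hc hS).elim

end Projection

/-! ### Hahn–Banach extension and conclusion -/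

theorem mainTheorem12 {𝕜 : Type*} [RCLike 𝕜]
    {X : Type*} [NormedAddCommGroup X] [NormedSpace 𝕜 X] [CompleteSpace X]
    (hX : IsHereditarily 𝕜 (SeqCZero 𝕜) X) :
    IsSubprojective 𝕜 X := by
  intro M hM hMinf
  obtain ⟨N, hNM, -, ⟨Φ⟩⟩ := hX M hM hMinf
  let J : SeqCZero 𝕜 →L[𝕜] X := N.subtypeL.comp Φ.symm.toContinuousLinearMap
  choose f hfext hfnorm using fun i =>
    exists_extension_norm_eq N ((SeqCZero.coord i).comp Φ.toContinuousLinearMap)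
  have hf : ∀ i b, f i (J b) = b i := fun i b => by
    have := hfext i (Φ.symm b)
    simpa [J] using this
  have hfC : ∀ i, ‖f i‖ ≤ 1 * ‖Φ.toContinuousLinearMap‖ := fun i => by
    rw [hfnorm]
    exact (ContinuousLinearMap.opNorm_comp_le _ _).trans
      (by gcongr; exact SeqCZero.norm_coord_le i)
  obtain ⟨g, hgf, hgC, hosc⟩ := hX.exists_cauchy_convexTail hfC
  obtain ⟨V, Q, hVJ, hQV⟩ := exists_complemented_of_convexTail hf hgC hgf hosc
  have hcompl : V.range.ClosedComplemented := by
    -- As `Q ∘ V` is the identity, `V ∘ Q` is a projection onto the range of `V`.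
    refine ⟨(V.comp Q).codRestrict V.range fun x => ⟨Q x, rfl⟩, ?_⟩
    rintro ⟨_, a, rfl⟩
    exact Subtype.ext (congrArg V (hQV a))
  refine ⟨V.range, ?_, hcompl.isClosed, fun hfin => ?_, hcompl⟩
  · rintro _ ⟨a, rfl⟩
    obtain ⟨b, hb⟩ := hVJ a
    exact hNM (hb ▸ (Φ.symm b).2)
  · have hinj : Function.Injective V := Function.LeftInverse.injective hQV
    exact SeqCZero.not_finiteDimensional
      ((LinearEquiv.ofInjective V.toLinearMap hinj).symm.finiteDimensional)
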